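/- For a real polynomial $\tau$ put $$\hat T(\tau)=(1-z^2)\Big(D_z^2-2\frac{\tau_z}{\tau}D_z+\frac{\tau_{zz}}{\tau}\Big)-2zD_z .$$ Real polynomials $\{\pi_i\}_{i\in\mathbb N_0}$ are called a family of exceptional Legendre polynomials for the weight $\tau^{-2}$, with pairwise distinct real eigenvalues $\lambda_i$, if $\tau$ has no zero on $[-1,1]$ and: (i) the $\pi_i$ are (nonzero) eigenfunctions, $\hat T(\tau)\pi_i=\lambda_i\pi_i$, of the Sturm--Liouville problem on $[-1,1]$ with $p=(1-z^2)\tau^{-2}$, i.e. $(p\,\pi_i')'+(1-z^2)\tau_{zz}\tau^{-3}\pi_i=\lambda_i\tau^{-2}\pi_i$ and $p\,\pi_i'\to0$ at $\pm1$; (ii) $\{\deg\pi_i\}$ contains all but finitely many positive integers; (iii) $\int_{-1}^1\pi_i\pi_j\tau^{-2}\,dz=0$ for $i\ne j$; (iv) the span of the $\pi_i$ is dense in $L^2([-1,1],\tau^{-2}dz)$. Let $\{\pi_i\}$ be such a family, with $\int_{-1}^1\pi_i\pi_j\tau^{-2}\,du=\nu_i\delta_{ij}$, $\nu_i>0$.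 Fix $m\in\mathbb N_0$ and $t\in\mathbb R$, and for $z\in[-1,1]$ set $$\rho_{ij}(z)=\int_{-1}^z\frac{\pi_i(u)\pi_j(u)}{\tau(u)^2}\,du,\qquad \tau_m=\tau\,(1+t\rho_{mm}),\qquad \pi_{m;i}=(1+t\rho_{mm})\pi_i-t\rho_{im}\pi_m ,$$ and assume that $\tau_m$ and all $\pi_{m;i}$ are (restrictions to $[-1,1]$ of) polynomials. Let $\nu_{m;i}=\nu_i$ for $i\ne m$ and $\nu_{m;m}=(t+\nu_m^{-1})^{-1}$ (if $t=-\nu_m^{-1}$, the condition $\nu_{m;m}>0$ is understood to fail). Then: 1. If $\tau>0$ on $[-1,1]$, then $\tau_m>0$ on $[-1,1]$ if and only if $\nu_{m;m}>0$. Without assuming $\tau>0$, $\tau_m$ has no zero on $[-1,1]$ if and only if $\nu_{m;m}>0$. 2. If $\nu_{m;m}>0$, then $\{\pi_{m;i}\}_{i\in\mathbb N_0}$ is a family of exceptional Legendre polynomials for the weight $\tau_m^{-2}$, with the same eigenvalues $\lambda_i$ (in particular it is complete in $L^2([-1,1],\tau_m^{-2}dz)$), and $$\int_{-1}^1\frac{\pi_{m;i}(u)\pi_{m;j}(u)}{\tau_m(u)^2}\,du=\nu_{m;i}\,\delta_{ij},\qquad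 i,j\in\mathbb N_0 .$$ -/

import Mathlib

open MeasureTheory Filter Topology Polynomial

noncomputable section

namespace ExcLegendre

/-- The operator `T̂(τ) = (1 - z²)(D² - 2 (τ'/τ) D + τ''/τ) - 2 z D`, applied to a polynomial `y`
and evaluated at a point `z` (meaningful where `τ(z) ≠ 0`). -/
def opT (τ y : ℝ[X]) (z : ℝ) : ℝ :=
  (1 - z ^ 2) *
      ((derivative (derivative y)).eval z
        - 2 * ((derivative τ).eval z / τ.eval z) * (derivative y).eval z
        + (derivative (derivative τ)).eval z / τ.eval z * y.eval z)
    - 2 * z * (derivative y).eval z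

/-- `T̂(τ)` is in Sturm-Liouville form with `p = (1 - z²) τ⁻²`, `q = (1 - z²) τ'' τ⁻³` and
weight `τ⁻²`: one has `τ⁻² T̂(τ) y = (p y')' + q y`. -/
theorem sturmLiouville_form (τ y : ℝ[X]) (z : ℝ) (hz : τ.eval z ≠ 0) :
    deriv (fun x => (1 - x ^ 2) / (τ.eval x) ^ 2 * (derivative y).eval x) z
        + (1 - z ^ 2) * (derivative (derivative τ)).eval z / (τ.eval z) ^ 3 * y.eval z
      = opT τ y z / (τ.eval z) ^ 2 := by
  have h1 : HasDerivAt (fun x : ℝ => 1 - x ^ 2) (-(2 * z)) z := by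
    simpa using ((hasDerivAt_id z).pow 2).const_sub 1
  have h2 := (τ.hasDerivAt z).pow 2
  have h3 := (derivative y).hasDerivAt z
  have h4 := (h1.div h2 (pow_ne_zero 2 hz)).mul h3
  have h5 : deriv (fun x => (1 - x ^ 2) / (τ.eval x) ^ 2 * (derivative y).eval x) z = _ := h4.deriv
  rw [h5, opT]
  simp only [Pi.div_apply, Pi.pow_apply]
  field_simp
  ring

/-- The polynomial `y` is an eigenfunction, with eigenvalue `c`, of the singular Sturm-Liouville
problem on `[-1,1]` attached to `T̂(τ)`: it is nonzero, satisfies `T̂(τ) y = c y`, that is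
`(p y')' + q y = c τ⁻² y` with `p = (1 - z²) τ⁻²` (see `sturmLiouville_form`), and the boundary
conditions `p y' → 0` at both end points. -/
structure IsSLEigenfunction (τ : ℝ[X]) (c : ℝ) (y : ℝ[X]) : Prop where
  ne_zero : y ≠ 0
  eigen : ∀ z ∈ Set.Icc (-1 : ℝ) 1, opT τ y z = c * y.eval z
  bdry_left : Tendsto (fun z : ℝ => (1 - z ^ 2) / (τ.eval z) ^ 2 * (derivative y).eval z)
    (𝓝[>] (-1)) (𝓝 0)
  bdry_right : Tendsto (fun z : ℝ => (1 - z ^ 2) / (τ.eval z) ^ 2 * (derivative y).eval z)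
    (𝓝[<] 1) (𝓝 0)

/-- The measure `τ(z)⁻² dz` on `[-1,1]`. -/
def weightMeasure (τ : ℝ[X]) : Measure ℝ :=
  (volume.restrict (Set.Icc (-1 : ℝ) 1)).withDensity
    (fun z => ENNReal.ofReal (1 / (τ.eval z) ^ 2))

/-- The linear span of the polynomials `P i` is dense in the Hilbert space
`L²([-1,1], τ⁻² dz)`. -/
def IsCompleteFamily (τ : ℝ[X]) (P : ℕ → ℝ[X]) : Prop :=
  (Submodule.span ℝ {f : Lp ℝ 2 (weightMeasure τ) |
    ∃ i, f =ᵐ[weightMeasure τ] fun z => (P i).eval z}).topologicalClosure = ⊤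

/-- `P` is a family of exceptional Legendre polynomials for the weight `τ⁻²`, with (pairwise
distinct) eigenvalues `lam i`. -/
structure IsExceptionalLegendreFamily (τ : ℝ[X]) (lam : ℕ → ℝ) (P : ℕ → ℝ[X]) : Prop where
  nonvanishing : ∀ z ∈ Set.Icc (-1 : ℝ) 1, τ.eval z ≠ 0
  distinct : ∀ i j, i ≠ j → lam i ≠ lam j
  sturmLiouville : ∀ i, IsSLEigenfunction τ (lam i) (P i)
  degrees : {n : ℕ | ∀ i, (P i).natDegree ≠ n}.Finite
  orthogonal : ∀ i j, i ≠ j →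
    ∫ u in (-1 : ℝ)..1, (P i).eval u * (P j).eval u / (τ.eval u) ^ 2 = 0
  complete : IsCompleteFamily τ P

/-- `ρ_{ij}(z) = ∫_{-1}^z π_i π_j τ⁻² du`. -/
def rho (τ : ℝ[X]) (π : ℕ → ℝ[X]) (i j : ℕ) (z : ℝ) : ℝ :=
  ∫ u in (-1 : ℝ)..z, (π i).eval u * (π j).eval u / (τ.eval u) ^ 2

/-- `τ_m(z;t) = τ(z) (1 + t ρ_{mm}(z))`. -/
def tauStep (τ : ℝ[X]) (π : ℕ → ℝ[X]) (m : ℕ) (t z : ℝ) : ℝ :=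
  τ.eval z * (1 + t * rho τ π m m z)

/-- `π_{m;i}(z;t) = (1 + t ρ_{mm}(z)) π_i(z) - t ρ_{im}(z) π_m(z)`. -/
def piStep (τ : ℝ[X]) (π : ℕ → ℝ[X]) (m : ℕ) (t : ℝ) (i : ℕ) (z : ℝ) : ℝ :=
  (1 + t * rho τ π m m z) * (π i).eval z - t * rho τ π i m z * (π m).eval z

/-- The transformed norms: `ν_{m;i} = ν_i` for `i ≠ m`, and `ν_{m;m} = (t + ν_m⁻¹)⁻¹`. -/
def nuStep (ν : ℕ → ℝ) (m : ℕ) (t : ℝ) (i : ℕ) : ℝ :=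
  if i = m then (t + (ν m)⁻¹)⁻¹ else ν i

end ExcLegendre

end

/-! Divide everything by the denominators. With `φ_i = π_i/τ` the weight disappears, and
`π_{m;i}/τ_m` is the image of `φ_i` under the map `A f = f - t φ ∫fφ / R`, where `φ = φ_m` and `R =
1 + t∫φ²`, integrals running from `-1` to `z`.

Three facts about `A` do the analytic work. Differentiation gives `∫ Af·Ag = ∫fg - t ∫fφ ∫gφ / R`
(`prim_darbouxMap_mul`); at `z = 1` this yields orthogonality and the new norms. The map is onto the
continuous functions, with the explicit preimage `g + tφ ∫(gφ/R)` (`exists_darbouxMap_eq`), and it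
is bounded in L²; hence it carries a complete family to a complete one. Nonvanishing of `τ_m`
reduces to that of `R`, which is monotone from `1` to `1 + tν_m`.

The eigenvalue equation, cleared of denominators, is a polynomial identity (`eigenPoly`). It
transforms correctly because Lagrange's identity expresses the integral `ρ_{im}` through a
Wronskian. Its top coefficient gives `λ = -d(d+1)` with `d = deg π - deg τ`, so equal eigenvalues
force equal `d`, up to `d ↦ -1-d`, and cofiniteness of degrees is inherited. -/

noncomputable section

namespace ExcLegendre

/-! ### Calculus of the rank-one transformation -/

/-- The primitive `∫_{-1}^z f`. -/
def prim (f : ℝ → ℝ) (z : ℝ) : ℝ := ∫ u in (-1 : ℝ)..z, f u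

section Primitive

variable {f g : ℝ → ℝ} {z : ℝ}

theorem intervalIntegrable_of_continuousOn (hf : ContinuousOn f (Set.Icc (-1) 1))
    (hz : z ∈ Set.Icc (-1 : ℝ) 1) : IntervalIntegrable f volume (-1) z := by
  apply ContinuousOn.intervalIntegrable
  rw [Set.uIcc_of_le hz.1]
  exact hf.mono (Set.Icc_subset_Icc le_rfl hz.2)

theorem prim_neg_one : prim f (-1) = 0 := by simp [prim]

theorem continuousOn_prim (hf : ContinuousOn f (Set.Icc (-1) 1)) :
    ContinuousOn (prim f) (Set.Icc (-1) 1) := by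
  have h := intervalIntegral.continuousOn_primitive_interval (μ := volume) (f := f) (a := -1) (b := 1)
    (by rw [Set.uIcc_of_le (by norm_num)]; exact hf.integrableOn_Icc)
  rwa [Set.uIcc_of_le (by norm_num)] at h

theorem hasDerivAt_prim (hf : ContinuousOn f (Set.Icc (-1) 1)) (hz : z ∈ Set.Ioo (-1 : ℝ) 1) :
    HasDerivAt (prim f) (f z) z := by
  have hn : Set.Icc (-1 : ℝ) 1 ∈ 𝓝 z := Icc_mem_nhds hz.1 hz.2
  refine intervalIntegral.integral_hasDerivAt_right
    (intervalIntegrable_of_continuousOn hf (Set.Ioo_subset_Icc_self hz)) ?_ (hf.continuousAt hn)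
  exact (hf.mono Set.Ioo_subset_Icc_self).stronglyMeasurableAtFilter isOpen_Ioo z hz

theorem prim_add (hf : ContinuousOn f (Set.Icc (-1) 1)) (hg : ContinuousOn g (Set.Icc (-1) 1))
    (hz : z ∈ Set.Icc (-1 : ℝ) 1) : prim (fun u => f u + g u) z = prim f z + prim g z :=
  intervalIntegral.integral_add (intervalIntegrable_of_continuousOn hf hz)
    (intervalIntegrable_of_continuousOn hg hz)

theorem prim_const_mul (c : ℝ) : prim (fun u => c * f u) z = c * prim f z :=
  intervalIntegral.integral_const_mul c f

/-- A function that is continuous on `[-1,1]`, vanishes at `-1` and has derivative `f` inside is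
the primitive of `f`. -/
theorem prim_eq_of_hasDerivAt {F : ℝ → ℝ} (hF : ContinuousOn F (Set.Icc (-1) 1))
    (hd : ∀ x ∈ Set.Ioo (-1 : ℝ) 1, HasDerivAt F (f x) x) (hf : ContinuousOn f (Set.Icc (-1) 1))
    (h0 : F (-1) = 0) (hz : z ∈ Set.Icc (-1 : ℝ) 1) : prim f z = F z := by
  have := intervalIntegral.integral_eq_sub_of_hasDerivAt_of_le hz.1
    (hF.mono (Set.Icc_subset_Icc le_rfl hz.2))
    (fun x hx => hd x ⟨hx.1, hx.2.trans_le hz.2⟩) (intervalIntegrable_of_continuousOn hf hz)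
  rw [prim, this, h0, sub_zero]

theorem prim_congr (h : ∀ x ∈ Set.Icc (-1 : ℝ) 1, f x = g x) (hz : z ∈ Set.Icc (-1 : ℝ) 1) :
    prim f z = prim g z := by
  apply intervalIntegral.integral_congr
  rw [Set.uIcc_of_le hz.1]
  exact fun x hx => h x ⟨hx.1, hx.2.trans hz.2⟩

theorem prim_mono (hf : ContinuousOn f (Set.Icc (-1) 1)) (h0 : ∀ x, 0 ≤ f x)
    (hz : z ∈ Set.Icc (-1 : ℝ) 1) : 0 ≤ prim f z ∧ prim f z ≤ prim f 1 := by
  have h1 : (1 : ℝ) ∈ Set.Icc (-1 : ℝ) 1 := by norm_num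
  refine ⟨intervalIntegral.integral_nonneg hz.1 fun x _ => h0 x, ?_⟩
  have hsub := intervalIntegral.integral_interval_sub_left
    (intervalIntegrable_of_continuousOn hf h1) (intervalIntegrable_of_continuousOn hf hz)
  have hnn : 0 ≤ ∫ x in z..1, f x := intervalIntegral.integral_nonneg hz.2 fun x _ => h0 x
  simp only [prim]
  linarith

end Primitive

/-! ### The rank-one map and its L² geometry -/

section Darboux

variable {f g φ : ℝ → ℝ} {t : ℝ}

/-- `1 + t ∫_{-1}^z φ²`. -/
def darbouxFactor (φ : ℝ → ℝ) (t z : ℝ) : ℝ := 1 + t * prim (fun u => φ u * φ u) z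

/-- The rank-one transformation `f ↦ f - t φ (∫_{-1}^z f φ) / (1 + t ∫_{-1}^z φ²)`. -/
def darbouxMap (φ : ℝ → ℝ) (t : ℝ) (f : ℝ → ℝ) (z : ℝ) : ℝ :=
  f z - t * φ z * prim (fun u => f u * φ u) z / darbouxFactor φ t z

theorem continuousOn_darbouxFactor (hφ : ContinuousOn φ (Set.Icc (-1) 1)) :
    ContinuousOn (darbouxFactor φ t) (Set.Icc (-1) 1) :=
  continuousOn_const.add (continuousOn_const.mul (continuousOn_prim (hφ.mul hφ)))

theorem hasDerivAt_darbouxFactor (hφ : ContinuousOn φ (Set.Icc (-1) 1)) {z : ℝ}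
    (hz : z ∈ Set.Ioo (-1 : ℝ) 1) :
    HasDerivAt (darbouxFactor φ t) (t * (φ z * φ z)) z :=
  ((hasDerivAt_prim (hφ.mul hφ) hz).const_mul t).const_add 1

theorem continuousOn_darbouxMap (hf : ContinuousOn f (Set.Icc (-1) 1))
    (hφ : ContinuousOn φ (Set.Icc (-1) 1))
    (hR : ∀ z ∈ Set.Icc (-1 : ℝ) 1, darbouxFactor φ t z ≠ 0) :
    ContinuousOn (darbouxMap φ t f) (Set.Icc (-1) 1) :=
  hf.sub (((continuousOn_const.mul hφ).mul (continuousOn_prim (hf.mul hφ))).div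
    (continuousOn_darbouxFactor hφ) hR)

/-- The integral of `φ²` increases from `0`, so the factor is at least `1` when `t ≥ 0` and at least
its value at `1` when `t < 0`. -/
theorem darbouxFactor_pos_iff (hφ : ContinuousOn φ (Set.Icc (-1) 1)) :
    (∀ z ∈ Set.Icc (-1 : ℝ) 1, 0 < darbouxFactor φ t z) ↔ 0 < darbouxFactor φ t 1 := by
  refine ⟨fun h => h 1 (by norm_num), fun h z hz => ?_⟩
  have hφφ : ContinuousOn (fun u => φ u * φ u) (Set.Icc (-1) 1) := hφ.mul hφ
  obtain ⟨h0, h1⟩ := prim_mono hφφ (fun x => mul_self_nonneg (φ x)) hz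
  simp only [darbouxFactor] at h ⊢
  rcases le_or_gt 0 t with ht | ht
  · positivity
  · nlinarith

/-- The factor equals `1` at `-1`; by the intermediate value theorem a nonpositive value at `1`
would force a zero. -/
theorem darbouxFactor_ne_zero_iff (hφ : ContinuousOn φ (Set.Icc (-1) 1)) :
    (∀ z ∈ Set.Icc (-1 : ℝ) 1, darbouxFactor φ t z ≠ 0) ↔ 0 < darbouxFactor φ t 1 := by
  refine ⟨fun h => ?_, fun h z hz => ((darbouxFactor_pos_iff hφ).2 h z hz).ne'⟩
  by_contra! hle
  have h0 : darbouxFactor φ t (-1) = 1 := by simp [darbouxFactor, prim_neg_one]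
  obtain ⟨z, hz, hz0⟩ := intermediate_value_Icc' (by norm_num : (-1 : ℝ) ≤ 1)
    (continuousOn_darbouxFactor (t := t) hφ)
    (show (0 : ℝ) ∈ Set.Icc _ _ by rw [h0]; exact ⟨hle, by norm_num⟩)
  exact h z hz hz0

/-- Both sides vanish at `-1` and have the same derivative. The defect from an isometry is thus a
rank-one term, explicit at every `z`. -/
theorem prim_darbouxMap_mul (hf : ContinuousOn f (Set.Icc (-1) 1))
    (hg : ContinuousOn g (Set.Icc (-1) 1)) (hφ : ContinuousOn φ (Set.Icc (-1) 1))
    (hR : ∀ z ∈ Set.Icc (-1 : ℝ) 1, darbouxFactor φ t z ≠ 0) {z : ℝ}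
    (hz : z ∈ Set.Icc (-1 : ℝ) 1) :
    prim (fun u => darbouxMap φ t f u * darbouxMap φ t g u) z =
      prim (fun u => f u * g u) z
        - t * (prim (fun u => f u * φ u) z * prim (fun u => g u * φ u) z) / darbouxFactor φ t z := by
  refine prim_eq_of_hasDerivAt (F := fun z => prim (fun u => f u * g u) z
        - t * (prim (fun u => f u * φ u) z * prim (fun u => g u * φ u) z) / darbouxFactor φ t z)
    ?_ ?_ ((continuousOn_darbouxMap hf hφ hR).mul (continuousOn_darbouxMap hg hφ hR)) ?_ hz
  · exact (continuousOn_prim (hf.mul hg)).sub ((continuousOn_const.mul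
      ((continuousOn_prim (hf.mul hφ)).mul (continuousOn_prim (hg.mul hφ)))).div
      (continuousOn_darbouxFactor hφ) hR)
  · intro x hx
    have hRx := hR x (Set.Ioo_subset_Icc_self hx)
    have h := (hasDerivAt_prim (hf.mul hg) hx).sub
      ((((hasDerivAt_prim (hf.mul hφ) hx).mul (hasDerivAt_prim (hg.mul hφ) hx)).const_mul t).div
        (hasDerivAt_darbouxFactor (t := t) hφ hx) hRx)
    refine h.congr_deriv ?_
    simp only [darbouxMap, Pi.mul_apply]
    change f x * g x - ((t * (f x * φ x * prim (fun u => g u * φ u) x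
      + prim (fun u => f u * φ u) x * (g x * φ x))) * darbouxFactor φ t x
      - t * (prim (fun u => f u * φ u) x * prim (fun u => g u * φ u) x) * (t * (φ x * φ x)))
      / darbouxFactor φ t x ^ 2 = _
    field_simp
    ring
  · simp [prim_neg_one]

/-- The inverse of `darbouxMap`. -/
theorem exists_darbouxMap_eq (hg : ContinuousOn g (Set.Icc (-1) 1))
    (hφ : ContinuousOn φ (Set.Icc (-1) 1))
    (hR : ∀ z ∈ Set.Icc (-1 : ℝ) 1, darbouxFactor φ t z ≠ 0) :
    ∃ f, ContinuousOn f (Set.Icc (-1) 1) ∧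
      ∀ z ∈ Set.Icc (-1 : ℝ) 1, darbouxMap φ t f z = g z := by
  have hRc := continuousOn_darbouxFactor (t := t) hφ
  have hk : ContinuousOn (fun u => g u * φ u / darbouxFactor φ t u) (Set.Icc (-1) 1) :=
    (hg.mul hφ).div hRc hR
  set G := prim (fun u => g u * φ u / darbouxFactor φ t u) with hG
  have hGc : ContinuousOn G (Set.Icc (-1) 1) := continuousOn_prim hk
  have hfc : ContinuousOn (fun z => g z + t * φ z * G z) (Set.Icc (-1) 1) :=
    hg.add ((continuousOn_const.mul hφ).mul hGc)
  refine ⟨fun z => g z + t * φ z * G z, hfc, fun z hz => ?_⟩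
  -- With `f = g + tφG` and `G' = gφ/R`, one has `(RG)' = tφ²G + gφ = fφ`; the correction in
  -- `darbouxMap` is then exactly `tφG`.
  have key : prim (fun u => (g u + t * φ u * G u) * φ u) z = darbouxFactor φ t z * G z := by
    refine prim_eq_of_hasDerivAt (F := fun z => darbouxFactor φ t z * G z) (hRc.mul hGc) ?_
      (hfc.mul hφ) (by simp [hG, prim_neg_one]) hz
    intro x hx
    refine ((hasDerivAt_darbouxFactor hφ hx).mul (hasDerivAt_prim hk hx)).congr_deriv ?_
    have hRx := hR x (Set.Ioo_subset_Icc_self hx)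
    rw [← hG]
    field_simp
    ring
  have hRz := hR z hz
  rw [darbouxMap, key]
  field_simp
  ring

/-- `darbouxMap` is bounded in the `L²` norm on continuous functions. -/
theorem exists_prim_darbouxMap_sq_le (hφ : ContinuousOn φ (Set.Icc (-1) 1))
    (hR : ∀ z ∈ Set.Icc (-1 : ℝ) 1, darbouxFactor φ t z ≠ 0)
    (hpos : 0 < prim (fun u => φ u * φ u) 1) :
    ∃ C, 0 < C ∧ ∀ f, ContinuousOn f (Set.Icc (-1) 1) →
      prim (fun u => darbouxMap φ t f u * darbouxMap φ t f u) 1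
        ≤ C * prim (fun u => f u * f u) 1 := by
  have h1 : (1 : ℝ) ∈ Set.Icc (-1 : ℝ) 1 := by norm_num
  set ν := prim (fun u => φ u * φ u) 1 with hν
  refine ⟨1 + |t| * ν / |darbouxFactor φ t 1|, by positivity, fun f hf => ?_⟩
  rw [prim_darbouxMap_mul hf hf hφ hR h1]
  set a := prim (fun u => f u * φ u) 1 with ha
  set b := prim (fun u => f u * f u) 1 with hb
  -- Cauchy-Schwarz, from `∫(f + cφ)² ≥ 0` at the minimizing `c = -a/ν`.
  have hcs : a * a ≤ ν * b := by
    have hc : ∀ c : ℝ, 0 ≤ b + c * a + (c * a + c ^ 2 * ν) := by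
      intro c
      have hff : ContinuousOn (fun u => f u * f u) (Set.Icc (-1) 1) := hf.mul hf
      have hfφ : ContinuousOn (fun u => c * (f u * φ u)) (Set.Icc (-1) 1) :=
        continuousOn_const.mul (hf.mul hφ)
      have hφφ : ContinuousOn (fun u => c ^ 2 * (φ u * φ u)) (Set.Icc (-1) 1) :=
        continuousOn_const.mul (hφ.mul hφ)
      have he : prim (fun u => (f u + c * φ u) * (f u + c * φ u)) 1
          = b + c * a + (c * a + c ^ 2 * ν) := by
        rw [hb, ha, hν, ← prim_const_mul, ← prim_const_mul, ← prim_add hff hfφ h1,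
          ← prim_add hfφ hφφ h1, ← prim_add (f := fun u => f u * f u + c * (f u * φ u))
            (g := fun u => c * (f u * φ u) + c ^ 2 * (φ u * φ u))
            (hff.add hfφ) (hfφ.add hφφ) h1]
        exact prim_congr (fun x _ => by ring) h1
      rw [← he]
      exact intervalIntegral.integral_nonneg h1.1 fun x _ => mul_self_nonneg _
    have := hc (-a / ν)
    have h2 : b + -a / ν * a + (-a / ν * a + (-a / ν) ^ 2 * ν) = (ν * b - a * a) / ν := by
      field_simp
      ring
    rw [h2, le_div_iff₀ hpos] at this
    linarith
  have habs : -(t * (a * a) / darbouxFactor φ t 1)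
      ≤ |t| * (ν * b) / |darbouxFactor φ t 1| := by
    refine (neg_le_abs _).trans ?_
    rw [abs_div, abs_mul, abs_mul_self]
    gcongr
  calc _ = b + -(t * (a * a) / darbouxFactor φ t 1) := by ring
    _ ≤ b + |t| * (ν * b) / |darbouxFactor φ t 1| := by gcongr
    _ = _ := by ring

end Darboux

/-! ### The operator `opT` as a polynomial identity -/

/-- The polynomial `τ (T̂(τ) y - c y)`. -/
def eigenPoly (τ : ℝ[X]) (c : ℝ) (y : ℝ[X]) : ℝ[X] :=
  (1 - X ^ 2) * (τ * derivative (derivative y) - 2 * (derivative τ * derivative y)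
    + derivative (derivative τ) * y) - 2 * (X * (τ * derivative y)) - C c * (τ * y)

theorem opT_eq_iff {τ y : ℝ[X]} {c z : ℝ} (hz : τ.eval z ≠ 0) :
    opT τ y z = c * y.eval z ↔ (eigenPoly τ c y).eval z = 0 := by
  have h : (eigenPoly τ c y).eval z = τ.eval z * (opT τ y z - c * y.eval z) := by
    simp only [eigenPoly, opT, eval_sub, eval_mul, eval_add, eval_one, eval_pow, eval_X, eval_C,
      eval_ofNat]
    field_simp
  rw [h, mul_eq_zero, sub_eq_zero, or_iff_right hz]

/-- Lets equations checked only inside the interval, where primitives are differentiable, hold as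
polynomial identities, including at the end points and in the leading coefficient. -/
theorem eq_zero_of_eval_Ioo {p : ℝ[X]} (h : ∀ z ∈ Set.Ioo (-1 : ℝ) 1, p.eval z = 0) : p = 0 :=
  eq_zero_of_infinite_isRoot p ((Set.Ioo_infinite (by norm_num : (-1 : ℝ) < 1)).mono h)

/-- The leading coefficient of `eigenPoly τ c y` determines the eigenvalue. -/
theorem eigenvalue_eq_of_eigenPoly_eq_zero {τ y : ℝ[X]} {c : ℝ} (hτ : τ ≠ 0) (hy : y ≠ 0)
    (h : eigenPoly τ c y = 0) :
    c = -(((y.natDegree : ℝ) - τ.natDegree) * ((y.natDegree : ℝ) - τ.natDegree + 1)) := by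
  have dX : ∀ p : ℝ[X], (X * derivative p).natDegree ≤ p.natDegree := fun p => by
    rcases eq_or_ne (derivative p) 0 with h0 | h0
    · simp [h0]
    · have h1 : p.natDegree ≠ 0 := fun h => h0 (by
        rw [eq_C_of_natDegree_eq_zero h, derivative_C])
      have := natDegree_derivative_lt h1
      rw [natDegree_X_mul h0]
      omega
  have dX2 : ∀ p : ℝ[X], (X * (X * derivative (derivative p))).natDegree ≤ p.natDegree := fun p => by
    have e : X * (X * derivative (derivative p)) = X * derivative (X * derivative p)
        - X * derivative p := by
      simp only [derivative_mul, derivative_X]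
      ring
    rw [e]
    exact (natDegree_sub_le _ _).trans (max_le ((dX _).trans (dX _)) (dX _))
  have cX : ∀ (p : ℝ[X]) (k : ℕ), (X * derivative p).coeff k = k * p.coeff k := fun p k => by
    cases k with
    | zero => simp
    | succ k => rw [coeff_X_mul, coeff_derivative]; push_cast; ring
  have cX2 : ∀ (p : ℝ[X]) (k : ℕ),
      (X * (X * derivative (derivative p))).coeff k = (k * (k - 1)) * p.coeff k := fun p k => by
    have e : X * (X * derivative (derivative p)) = X * derivative (X * derivative p)
        - X * derivative p := by
      simp only [derivative_mul, derivative_X]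
      ring
    rw [e, coeff_sub, cX, cX]
    ring
  have d1 : ∀ p : ℝ[X], (derivative p).natDegree ≤ p.natDegree := fun p =>
    (natDegree_derivative_le p).trans (Nat.sub_le _ _)
  have c1 : ∀ p : ℝ[X], (derivative p).coeff p.natDegree = 0 := fun p => by
    rw [coeff_derivative, coeff_eq_zero_of_natDegree_lt (Nat.lt_succ_self _), zero_mul]
  have c2 : ∀ p : ℝ[X], (derivative (derivative p)).coeff p.natDegree = 0 := fun p => by
    rw [coeff_derivative, coeff_eq_zero_of_natDegree_lt ((d1 p).trans_lt (Nat.lt_succ_self _)),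
      zero_mul]
  have d2 : ∀ p : ℝ[X], (derivative (derivative p)).natDegree ≤ p.natDegree := fun p =>
    (d1 _).trans (d1 p)
  -- Written with `X·D` and `X²·D²`, which do not raise the degree and multiply coefficients by `k`
  -- and `k(k-1)`. The terms with bare derivatives contribute nothing in the top degree.
  have e : eigenPoly τ c y = τ * derivative (derivative y) - C 2 * (derivative τ * derivative y)
      + derivative (derivative τ) * y - τ * (X * (X * derivative (derivative y)))
      + C 2 * ((X * derivative τ) * (X * derivative y))
      - (X * (X * derivative (derivative τ))) * y - C 2 * (τ * (X * derivative y))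
      - C c * (τ * y) := by
    rw [eigenPoly, show (C 2 : ℝ[X]) = 2 from rfl]
    ring
  have hc := congrArg (fun p => p.coeff (τ.natDegree + y.natDegree)) h
  simp only [e, coeff_sub, coeff_add, coeff_C_mul, coeff_zero,
    coeff_mul_add_eq_of_natDegree_le (le_refl τ.natDegree) (d2 y),
    coeff_mul_add_eq_of_natDegree_le (d1 τ) (d1 y),
    coeff_mul_add_eq_of_natDegree_le (d2 τ) (le_refl y.natDegree),
    coeff_mul_add_eq_of_natDegree_le (le_refl τ.natDegree) (dX2 y),
    coeff_mul_add_eq_of_natDegree_le (dX τ) (dX y),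
    coeff_mul_add_eq_of_natDegree_le (dX2 τ) (le_refl y.natDegree),
    coeff_mul_add_eq_of_natDegree_le (le_refl τ.natDegree) (dX y),
    coeff_mul_add_eq_of_natDegree_le (le_refl τ.natDegree) (le_refl y.natDegree),
    c1, c2, cX, cX2] at hc
  have hl : τ.coeff τ.natDegree * y.coeff y.natDegree ≠ 0 :=
    mul_ne_zero (leadingCoeff_ne_zero.2 hτ) (leadingCoeff_ne_zero.2 hy)
  have : (c + ((y.natDegree : ℝ) - τ.natDegree) * ((y.natDegree : ℝ) - τ.natDegree + 1))
      * (τ.coeff τ.natDegree * y.coeff y.natDegree) = 0 := by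
    linear_combination -hc
  rcases mul_eq_zero.1 this with h1 | h1
  · linarith
  · exact absurd h1 hl

/-- Eigenfunctions of `opT τ` and `opT σ` with the same eigenvalues have cofinitely many degrees
simultaneously. -/
theorem finite_missing_degrees {τ σ : ℝ[X]} {lam : ℕ → ℝ} {P Q : ℕ → ℝ[X]} (hτ : τ ≠ 0)
    (hσ : σ ≠ 0) (hP : ∀ i, P i ≠ 0) (hQ : ∀ i, Q i ≠ 0)
    (eP : ∀ i, eigenPoly τ (lam i) (P i) = 0) (eQ : ∀ i, eigenPoly σ (lam i) (Q i) = 0)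
    (hfin : {n : ℕ | ∀ i, (P i).natDegree ≠ n}.Finite) :
    {n : ℕ | ∀ i, (Q i).natDegree ≠ n}.Finite := by
  obtain ⟨K, hK⟩ := hfin.bddAbove
  refine (Set.finite_Iic (K + σ.natDegree + σ.natDegree)).subset fun n hn => ?_
  by_contra hlt
  simp only [Set.mem_Iic, not_le] at hlt
  -- The degree sought among the `P i` has the same difference from `deg τ` as `n` has from `deg σ`.
  -- It exceeds `K`, so it occurs.
  have hk : n - σ.natDegree + τ.natDegree ∉ {n : ℕ | ∀ i, (P i).natDegree ≠ n} := fun hm => by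
    have := hK hm
    omega
  simp only [Set.mem_ofPred_eq, not_forall, not_not] at hk
  obtain ⟨i, hi⟩ := hk
  have h1 := eigenvalue_eq_of_eigenPoly_eq_zero hτ (hP i) (eP i)
  have h2 := eigenvalue_eq_of_eigenPoly_eq_zero hσ (hQ i) (eQ i)
  have hi' : ((P i).natDegree : ℝ) + σ.natDegree = n + τ.natDegree := by
    have : (P i).natDegree + σ.natDegree = n + τ.natDegree := by omega
    exact_mod_cast this
  have hlt' : (σ.natDegree : ℝ) + σ.natDegree < n := by
    have : σ.natDegree + σ.natDegree < n := by omega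
    exact_mod_cast this
  have h0 : (0 : ℝ) ≤ (Q i).natDegree := Nat.cast_nonneg _
  -- The two roots of the quadratic for `deg (Q i)`; the second factor is positive because `n > 2
  -- deg σ`.
  have hprod : (((Q i).natDegree : ℝ) - n) * ((Q i).natDegree + n - 2 * σ.natDegree + 1) = 0 := by
    have hd : ((P i).natDegree : ℝ) = n - σ.natDegree + τ.natDegree := by linarith
    rw [hd] at h1
    linear_combination h2 - h1
  rcases mul_eq_zero.1 hprod with h3 | h3
  · exact hn i (by exact_mod_cast sub_eq_zero.1 h3)
  · linarith

/-! ### The eigenvalue equation -/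

/-- Lagrange's identity for two eigenfunctions. -/
theorem lagrange_identity {τ y u : ℝ[X]} {a b z : ℝ}
    (hτ : ∀ z ∈ Set.Icc (-1 : ℝ) 1, τ.eval z ≠ 0) (hy : eigenPoly τ a y = 0)
    (hu : eigenPoly τ b u = 0) (hz : z ∈ Set.Icc (-1 : ℝ) 1) :
    (1 - z ^ 2) * ((derivative y).eval z * u.eval z - y.eval z * (derivative u).eval z)
        / τ.eval z ^ 2
      = (a - b) * prim (fun x => y.eval x * u.eval x / τ.eval x ^ 2) z := by
  rw [← prim_const_mul]
  have hcF : ∀ p : ℝ[X], ContinuousOn (fun x => p.eval x / τ.eval x ^ 2) (Set.Icc (-1) 1) :=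
    fun p => p.continuousOn.div (τ.continuousOn.pow 2) fun x hx => pow_ne_zero 2 (hτ x hx)
  refine (prim_eq_of_hasDerivAt (F := fun z => (1 - z ^ 2) *
    ((derivative y).eval z * u.eval z - y.eval z * (derivative u).eval z) / τ.eval z ^ 2)
    ?_ ?_ ?_ (by norm_num) hz).symm
  · convert hcF ((1 - X ^ 2) * (derivative y * u - y * derivative u)) using 2
    simp
  · intro x hx
    have hx0 := hτ x (Set.Ioo_subset_Icc_self hx)
    have h1 : HasDerivAt (fun z : ℝ => 1 - z ^ 2) (-(2 * x)) x := by
      simpa using ((hasDerivAt_id x).pow 2).const_sub 1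
    have h2 := h1.mul ((((derivative y).hasDerivAt x).mul (u.hasDerivAt x)).sub
      ((y.hasDerivAt x).mul ((derivative u).hasDerivAt x)))
    have hd := h2.div ((τ.hasDerivAt x).pow 2) (pow_ne_zero 2 hx0)
    refine hd.congr_deriv ?_
    have ey := congrArg (eval x) hy
    have eu := congrArg (eval x) hu
    simp only [eigenPoly, eval_sub, eval_mul, eval_add, eval_one, eval_pow, eval_X, eval_C,
      eval_ofNat, eval_zero] at ey eu
    simp only [Pi.mul_apply, Pi.sub_apply, Pi.pow_apply]
    field_simp
    linear_combination (τ.eval x * u.eval x) * ey - (τ.eval x * y.eval x) * eu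
  · convert hcF (C (a - b) * (y * u)) using 2
    simp [mul_div_assoc]

theorem derivative_eval_eq {p : ℝ[X]} {f : ℝ → ℝ} {z f' : ℝ}
    (h : ∀ x ∈ Set.Ioo (-1 : ℝ) 1, p.eval x = f x) (hz : z ∈ Set.Ioo (-1 : ℝ) 1)
    (hf : HasDerivAt f f' z) : (derivative p).eval z = f' :=
  (p.hasDerivAt z).unique (hf.congr_of_eventuallyEq
    (Filter.eventually_of_mem (Ioo_mem_nhds hz.1 hz.2) h))

/-- The transformed functions satisfy the transformed eigenvalue equation. -/
theorem eigenPoly_step {τ y u τ' y' : ℝ[X]} {a b t : ℝ}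
    (hτ : ∀ z ∈ Set.Icc (-1 : ℝ) 1, τ.eval z ≠ 0) (hy : eigenPoly τ a y = 0)
    (hu : eigenPoly τ b u = 0)
    (hτ' : ∀ z ∈ Set.Icc (-1 : ℝ) 1, τ'.eval z =
      τ.eval z * (1 + t * prim (fun x => u.eval x * u.eval x / τ.eval x ^ 2) z))
    (hy' : ∀ z ∈ Set.Icc (-1 : ℝ) 1, y'.eval z =
      (1 + t * prim (fun x => u.eval x * u.eval x / τ.eval x ^ 2) z) * y.eval z
        - t * prim (fun x => y.eval x * u.eval x / τ.eval x ^ 2) z * u.eval z) :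
    eigenPoly τ' a y' = 0 := by
  set R := fun z => 1 + t * prim (fun x => u.eval x * u.eval x / τ.eval x ^ 2) z
  set ρ := prim (fun x => y.eval x * u.eval x / τ.eval x ^ 2)
  have hc : ∀ p q : ℝ[X], ContinuousOn (fun x => p.eval x * q.eval x / τ.eval x ^ 2)
      (Set.Icc (-1) 1) := fun p q => (p.continuousOn.mul q.continuousOn).div
        (τ.continuousOn.pow 2) fun x hx => pow_ne_zero 2 (hτ x hx)
  have hR : ∀ z ∈ Set.Ioo (-1 : ℝ) 1,
      HasDerivAt R (t * (u.eval z * u.eval z / τ.eval z ^ 2)) z := fun z hz =>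
    ((hasDerivAt_prim (hc u u) hz).const_mul t).const_add 1
  have hρ : ∀ z ∈ Set.Ioo (-1 : ℝ) 1,
      HasDerivAt ρ (y.eval z * u.eval z / τ.eval z ^ 2) z := fun z hz =>
    hasDerivAt_prim (hc y u) hz
  have hτ1 : ∀ z ∈ Set.Ioo (-1 : ℝ) 1, (derivative τ').eval z =
      (derivative τ).eval z * R z + t * (u.eval z * u.eval z / τ.eval z) := fun z hz => by
    rw [derivative_eval_eq (fun x hx => hτ' x (Set.Ioo_subset_Icc_self hx)) hz
      ((τ.hasDerivAt z).mul (hR z hz))]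
    change (derivative τ).eval z * R z + τ.eval z * _ = _
    have := hτ z (Set.Ioo_subset_Icc_self hz)
    field_simp
  -- The terms `R'y` and `tρ'u` cancel, both being `t y u²/τ²`.
  have hy1 : ∀ z ∈ Set.Ioo (-1 : ℝ) 1, (derivative y').eval z =
      R z * (derivative y).eval z - t * ρ z * (derivative u).eval z := fun z hz => by
    rw [derivative_eval_eq (fun x hx => hy' x (Set.Ioo_subset_Icc_self hx)) hz
      (((hR z hz).mul (y.hasDerivAt z)).sub (((hρ z hz).const_mul t).mul (u.hasDerivAt z)))]
    have := hτ z (Set.Ioo_subset_Icc_self hz)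
    field_simp
    ring
  refine eq_zero_of_eval_Ioo fun z hz => ?_
  have hz' := Set.Ioo_subset_Icc_self hz
  have hz0 := hτ z hz'
  have hτ2 : (derivative (derivative τ')).eval z = (derivative (derivative τ)).eval z * R z
      + 2 * t * u.eval z * (derivative u).eval z * (τ.eval z)⁻¹ := by
    rw [derivative_eval_eq hτ1 hz ((((derivative τ).hasDerivAt z).mul (hR z hz)).add
      ((((u.hasDerivAt z).mul (u.hasDerivAt z)).div (τ.hasDerivAt z) hz0).const_mul t))]
    simp only [Pi.mul_apply]
    field_simp
    ring
  have hy2 : (derivative (derivative y')).eval z = R z * (derivative (derivative y)).eval z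
      + t * (u.eval z ^ 2 * (derivative y).eval z - y.eval z * u.eval z * (derivative u).eval z)
        * (τ.eval z)⁻¹ ^ 2 - t * ρ z * (derivative (derivative u)).eval z := by
    rw [derivative_eval_eq hy1 hz (((hR z hz).mul ((derivative y).hasDerivAt z)).sub
      (((hρ z hz).const_mul t).mul ((derivative u).hasDerivAt z)))]
    field_simp
    ring
  have hL := lagrange_identity hτ hy hu hz'
  have ey := congrArg (eval z) hy
  have eu := congrArg (eval z) hu
  simp only [eigenPoly, eval_sub, eval_mul, eval_add, eval_one, eval_pow, eval_X, eval_C,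
    eval_ofNat, eval_zero] at ey eu ⊢
  change _ = (a - b) * ρ z at hL
  have hτz : τ'.eval z = τ.eval z * R z := hτ' z hz'
  have hyz : y'.eval z = R z * y.eval z - t * ρ z * u.eval z := hy' z hz'
  rw [div_eq_iff (pow_ne_zero 2 hz0)] at hL
  have hs := mul_inv_cancel₀ hz0
  rw [hτ2, hy2, hτ1 z hz, hy1 z hz, hτz, hyz, div_eq_mul_inv]
  -- The equation for `u` has eigenvalue `b` instead of `a`, leaving a multiple of `(a - b)ρ`.
  -- Lagrange's identity `hL` cancels it against the Wronskian terms; `hs` only simplifies `τ τ⁻¹`.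
  linear_combination R z ^ 2 * ey - (t * ρ z * R z) * eu
    - (t * R z * u.eval z * (τ.eval z)⁻¹) * hL
    + ((1 - z ^ 2) * R z * t * (τ.eval z)⁻¹ * u.eval z
        * (u.eval z * (derivative y).eval z - y.eval z * (derivative u).eval z)
      - (a - b) * t * ρ z * R z * τ.eval z * u.eval z) * hs

/-! ### Completeness -/


variable {τ : ℝ[X]}

theorem isFiniteMeasure_weightMeasure (hτ : ∀ z ∈ Set.Icc (-1 : ℝ) 1, τ.eval z ≠ 0) :
    IsFiniteMeasure (weightMeasure τ) := by
  refine isFiniteMeasure_withDensity_ofReal ?_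
  have h : ContinuousOn (fun z => 1 / τ.eval z ^ 2) (Set.Icc (-1) 1) :=
    continuousOn_const.div (τ.continuousOn.pow 2) fun x hx => pow_ne_zero 2 (hτ x hx)
  exact h.integrableOn_Icc.hasFiniteIntegral

theorem integral_weightMeasure (f : ℝ → ℝ) :
    ∫ z, f z ∂weightMeasure τ = prim (fun z => f z / τ.eval z ^ 2) 1 := by
  rw [weightMeasure, integral_withDensity_eq_integral_toReal_smul
    (by fun_prop) (by simp), prim,
    intervalIntegral.integral_of_le (by norm_num), ← integral_Icc_eq_integral_Ioc]
  refine integral_congr_ae (ae_of_all _ fun z => ?_)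
  simp only [smul_eq_mul]
  rw [ENNReal.toReal_ofReal (by positivity)]
  ring

theorem memLp_weightMeasure (hτ : ∀ z ∈ Set.Icc (-1 : ℝ) 1, τ.eval z ≠ 0) {f : ℝ → ℝ}
    (hf : ContinuousOn f (Set.Icc (-1) 1)) : MemLp f 2 (weightMeasure τ) := by
  have := isFiniteMeasure_weightMeasure hτ
  have hac : weightMeasure τ ≪ volume.restrict (Set.Icc (-1 : ℝ) 1) :=
    withDensity_absolutelyContinuous _ _
  obtain ⟨C, hC⟩ := isCompact_Icc.exists_bound_of_continuousOn hf
  exact MemLp.of_bound ((hf.aestronglyMeasurable measurableSet_Icc).mono_ac hac) C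
    (hac.ae_le ((ae_restrict_iff' measurableSet_Icc).2 (ae_of_all _ hC)))

/-- Division by `τ` turns the weighted norm into the unweighted one, in which `darbouxMap` acts. -/
theorem norm_toLp_sq {f : ℝ → ℝ} (hf : MemLp f 2 (weightMeasure τ)) :
    ‖hf.toLp f‖ ^ 2 = prim (fun z => f z / τ.eval z * (f z / τ.eval z)) 1 := by
  have h : prim (fun z => f z / τ.eval z * (f z / τ.eval z)) 1
      = ∫ z, f z ^ 2 ∂weightMeasure τ := by
    rw [integral_weightMeasure]
    congr 1
    funext z
    rw [div_mul_div_comm, sq, sq]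
  have h0 : 0 ≤ ∫ z, f z ^ 2 ∂weightMeasure τ := integral_nonneg fun z => sq_nonneg _
  rw [h, Lp.norm_toLp, hf.eLpNorm_eq_integral_rpow_norm (by norm_num) (by norm_num)]
  simp only [ENNReal.toReal_ofNat, Real.rpow_ofNat, Real.norm_eq_abs, sq_abs]
  rw [ENNReal.toReal_ofReal (by positivity), ← Real.rpow_natCast, ← Real.rpow_mul h0]
  norm_num

/-- Polynomials as elements of `L²(τ⁻² dz)`. -/
def polyLp (hτ : ∀ z ∈ Set.Icc (-1 : ℝ) 1, τ.eval z ≠ 0) :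
    ℝ[X] →ₗ[ℝ] Lp ℝ 2 (weightMeasure τ) where
  toFun p := (memLp_weightMeasure hτ p.continuousOn).toLp (fun z => p.eval z)
  map_add' p q := by
    rw [← MemLp.toLp_add]
    exact MemLp.toLp_congr _ _ (ae_of_all _ fun z => by simp)
  map_smul' c p := by
    rw [RingHom.id_apply, ← MemLp.toLp_const_smul]
    exact MemLp.toLp_congr _ _ (ae_of_all _ fun z => by simp)

theorem span_eq_map_polyLp (hτ : ∀ z ∈ Set.Icc (-1 : ℝ) 1, τ.eval z ≠ 0) (P : ℕ → ℝ[X]) :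
    Submodule.span ℝ {f : Lp ℝ 2 (weightMeasure τ) |
      ∃ i, f =ᵐ[weightMeasure τ] fun z => (P i).eval z}
      = (Submodule.span ℝ (Set.range P)).map (polyLp hτ) := by
  rw [Submodule.map_span]
  congr 1
  ext f
  simp only [Set.mem_ofPred_eq, Set.mem_image, Set.mem_range, exists_exists_eq_and]
  refine exists_congr fun i => ?_
  have hi := memLp_weightMeasure hτ (P i).continuousOn
  constructor
  · intro h
    exact Lp.ext (hi.coeFn_toLp.trans h.symm)
  · rintro rfl
    exact hi.coeFn_toLp

theorem norm_toLp_sub_polyLp_sq (hτ : ∀ z ∈ Set.Icc (-1 : ℝ) 1, τ.eval z ≠ 0) {g : ℝ → ℝ}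
    (hg : MemLp g 2 (weightMeasure τ)) (q : ℝ[X]) :
    ‖hg.toLp g - polyLp hτ q‖ ^ 2 =
      prim (fun z => (g z - q.eval z) / τ.eval z * ((g z - q.eval z) / τ.eval z)) 1 := by
  have hq := memLp_weightMeasure hτ q.continuousOn
  have := norm_toLp_sq (hg.sub hq)
  rw [MemLp.toLp_sub hg hq] at this
  exact this

/-- Completeness, expressed by approximation of continuous functions. -/
theorem isCompleteFamily_iff (hτ : ∀ z ∈ Set.Icc (-1 : ℝ) 1, τ.eval z ≠ 0) (P : ℕ → ℝ[X]) :
    IsCompleteFamily τ P ↔ ∀ g : ℝ → ℝ, ContinuousOn g (Set.Icc (-1) 1) → ∀ ε > 0,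
      ∃ q ∈ Submodule.span ℝ (Set.range P),
        prim (fun z => (g z - q.eval z) / τ.eval z * ((g z - q.eval z) / τ.eval z)) 1 < ε := by
  rw [IsCompleteFamily, span_eq_map_polyLp hτ]
  constructor
  · intro h g hg ε hε
    have hgm := memLp_weightMeasure hτ hg
    have hmem : hgm.toLp g ∈ closure
        ((Submodule.span ℝ (Set.range P)).map (polyLp hτ) : Set (Lp ℝ 2 (weightMeasure τ))) := by
      rw [← Submodule.topologicalClosure_coe, h]
      trivial
    obtain ⟨_, ⟨q, hq, rfl⟩, hd⟩ := Metric.mem_closure_iff.1 hmem (√ε) (Real.sqrt_pos.2 hε)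
    refine ⟨q, hq, ?_⟩
    rw [dist_eq_norm, Real.lt_sqrt (norm_nonneg _)] at hd
    rwa [← norm_toLp_sub_polyLp_sq hτ hgm]
  · intro h
    have := isFiniteMeasure_weightMeasure hτ
    rw [← Submodule.dense_iff_topologicalClosure_eq_top, ← dense_closure]
    -- Bounded continuous functions are dense in L² of a finite measure, so approximating these
    -- suffices.
    refine (BoundedContinuousFunction.toLp_denseRange ℝ (weightMeasure τ) ℝ
      (p := 2) (by norm_num)).mono ?_
    rintro _ ⟨g, rfl⟩
    rw [Metric.mem_closure_iff]
    intro ε hε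
    have hg : ContinuousOn g (Set.Icc (-1) 1) := g.continuous.continuousOn
    obtain ⟨q, hq, hlt⟩ := h g hg (ε ^ 2) (by positivity)
    refine ⟨_, ⟨q, hq, rfl⟩, ?_⟩
    rw [← norm_toLp_sub_polyLp_sq hτ (memLp_weightMeasure hτ hg)] at hlt
    rw [dist_eq_norm]
    exact lt_of_pow_lt_pow_left₀ 2 hε.le hlt

/-! ### The transformed family -/

theorem continuousOn_eval_div {τ : ℝ[X]} (hτ : ∀ z ∈ Set.Icc (-1 : ℝ) 1, τ.eval z ≠ 0) (p : ℝ[X]) :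
    ContinuousOn (fun z => p.eval z / τ.eval z) (Set.Icc (-1) 1) :=
  p.continuousOn.div τ.continuousOn hτ

theorem rho_eq_prim (τ : ℝ[X]) (π : ℕ → ℝ[X]) (i j : ℕ) :
    rho τ π i j = prim fun u => (π i).eval u / τ.eval u * ((π j).eval u / τ.eval u) := by
  funext z
  simp only [rho, prim, div_mul_div_comm, sq]

theorem tauStep_eq (τ : ℝ[X]) (π : ℕ → ℝ[X]) (m : ℕ) (t z : ℝ) :
    tauStep τ π m t z
      = τ.eval z * darbouxFactor (fun u => (π m).eval u / τ.eval u) t z := by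
  rw [tauStep, rho_eq_prim, darbouxFactor]

theorem piStep_div_tauStep {τ : ℝ[X]} (π : ℕ → ℝ[X]) {m : ℕ} {t z : ℝ} (i : ℕ)
    (hz : τ.eval z ≠ 0) (hR : darbouxFactor (fun u => (π m).eval u / τ.eval u) t z ≠ 0) :
    piStep τ π m t i z / tauStep τ π m t z
      = darbouxMap (fun u => (π m).eval u / τ.eval u) t (fun u => (π i).eval u / τ.eval u) z := by
  rw [tauStep_eq, piStep, rho_eq_prim, rho_eq_prim, darbouxMap]
  change (darbouxFactor (fun u => (π m).eval u / τ.eval u) t z * _ - _) / _ = _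
  field_simp

/-- Boundary conditions hold automatically when the weight is regular at the end points. -/
theorem isSLEigenfunction_of_eigenPoly {τ y : ℝ[X]} {c : ℝ}
    (hτ : ∀ z ∈ Set.Icc (-1 : ℝ) 1, τ.eval z ≠ 0) (hy : y ≠ 0) (h : eigenPoly τ c y = 0) :
    IsSLEigenfunction τ c y := by
  have hlim : ∀ a ∈ Set.Icc (-1 : ℝ) 1, 1 - a ^ 2 = 0 →
      Tendsto (fun z : ℝ => (1 - z ^ 2) / (τ.eval z) ^ 2 * (derivative y).eval z) (𝓝 a) (𝓝 0) := by
    intro a ha ha0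
    have hc : ContinuousAt (fun z : ℝ => (1 - z ^ 2) / (τ.eval z) ^ 2 * (derivative y).eval z) a :=
      ((by fun_prop : ContinuousAt (fun z : ℝ => 1 - z ^ 2) a).div (τ.continuousAt.pow 2)
        (pow_ne_zero 2 (hτ a ha))).mul (derivative y).continuousAt
    simpa [ContinuousAt, ha0] using hc
  exact ⟨hy, fun z hz => (opT_eq_iff (hτ z hz)).2 (by rw [h, eval_zero]),
    (hlim (-1) (by norm_num) (by norm_num)).mono_left nhdsWithin_le_nhds,
    (hlim 1 (by norm_num) (by norm_num)).mono_left nhdsWithin_le_nhds⟩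

theorem IsSLEigenfunction.eigenPoly_eq_zero {τ y : ℝ[X]} {c : ℝ} (h : IsSLEigenfunction τ c y)
    (hτ : ∀ z ∈ Set.Icc (-1 : ℝ) 1, τ.eval z ≠ 0) : eigenPoly τ c y = 0 :=
  eq_zero_of_eval_Ioo fun z hz =>
    (opT_eq_iff (hτ z (Set.Ioo_subset_Icc_self hz))).1 (h.eigen z (Set.Ioo_subset_Icc_self hz))

/-! ### Linearity of the rank-one map -/

section DarbouxLinear

variable {φ f g : ℝ → ℝ} {t z : ℝ}

theorem darbouxMap_add (hφ : ContinuousOn φ (Set.Icc (-1) 1)) (hf : ContinuousOn f (Set.Icc (-1) 1))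
    (hg : ContinuousOn g (Set.Icc (-1) 1)) (hz : z ∈ Set.Icc (-1 : ℝ) 1) :
    darbouxMap φ t (fun u => f u + g u) z = darbouxMap φ t f z + darbouxMap φ t g z := by
  have h : prim (fun u => (f u + g u) * φ u) z
      = prim (fun u => f u * φ u) z + prim (fun u => g u * φ u) z := by
    simp only [add_mul]
    exact prim_add (hf.mul hφ) (hg.mul hφ) hz
  rw [darbouxMap, h, darbouxMap, darbouxMap]
  ring

theorem darbouxMap_const_mul (c : ℝ) :
    darbouxMap φ t (fun u => c * f u) z = c * darbouxMap φ t f z := by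
  have h : prim (fun u => c * f u * φ u) z = c * prim (fun u => f u * φ u) z := by
    simp only [mul_assoc]
    exact prim_const_mul c
  rw [darbouxMap, h, darbouxMap]
  ring

theorem darbouxMap_congr (h : ∀ x ∈ Set.Icc (-1 : ℝ) 1, f x = g x) (hz : z ∈ Set.Icc (-1 : ℝ) 1) :
    darbouxMap φ t f z = darbouxMap φ t g z := by
  rw [darbouxMap, darbouxMap, h z hz, prim_congr (fun x hx => by rw [h x hx]) hz]

end DarbouxLinear

/-- Completeness is preserved by `darbouxMap`. -/
theorem IsCompleteFamily.darboux {τ σ : ℝ[X]} {P Q : ℕ → ℝ[X]} {φ : ℝ → ℝ} {t : ℝ}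
    (hτ : ∀ z ∈ Set.Icc (-1 : ℝ) 1, τ.eval z ≠ 0) (hσ : ∀ z ∈ Set.Icc (-1 : ℝ) 1, σ.eval z ≠ 0)
    (hφ : ContinuousOn φ (Set.Icc (-1) 1))
    (hR : ∀ z ∈ Set.Icc (-1 : ℝ) 1, darbouxFactor φ t z ≠ 0)
    (hpos : 0 < prim (fun u => φ u * φ u) 1)
    (hPQ : ∀ i, ∀ z ∈ Set.Icc (-1 : ℝ) 1, (Q i).eval z / σ.eval z
      = darbouxMap φ t (fun u => (P i).eval u / τ.eval u) z)
    (hP : IsCompleteFamily τ P) : IsCompleteFamily σ Q := by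
  have h1 : (1 : ℝ) ∈ Set.Icc (-1 : ℝ) 1 := by norm_num
  rw [isCompleteFamily_iff hτ] at hP
  rw [isCompleteFamily_iff hσ]
  intro g hg ε hε
  obtain ⟨C, hC0, hC⟩ := exists_prim_darbouxMap_sq_le hφ hR hpos
  -- Pull the target `g/σ` back to `f`, approximate `fτ` by the old family within `ε/C`, and push
  -- forward: boundedness multiplies the squared error by at most `C`.
  obtain ⟨f, hf, hfg⟩ := exists_darbouxMap_eq (hg.div σ.continuousOn hσ) hφ hR
  obtain ⟨q, hq, hlt⟩ := hP (fun z => f z * τ.eval z) (hf.mul τ.continuousOn) (ε / C)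
    (by positivity)
  have hspan : ∃ r ∈ Submodule.span ℝ (Set.range Q), ∀ z ∈ Set.Icc (-1 : ℝ) 1,
      r.eval z / σ.eval z = darbouxMap φ t (fun u => q.eval u / τ.eval u) z := by
    clear hlt
    induction hq using Submodule.span_induction with
    | mem x hx =>
      obtain ⟨i, rfl⟩ := hx
      exact ⟨Q i, Submodule.subset_span ⟨i, rfl⟩, hPQ i⟩
    | zero => exact ⟨0, Submodule.zero_mem _, fun z _ => by simp [darbouxMap, prim]⟩
    | add x y _ _ hx hy =>
      obtain ⟨r, hr, hrx⟩ := hx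
      obtain ⟨s, hs, hsy⟩ := hy
      refine ⟨r + s, Submodule.add_mem _ hr hs, fun z hz => ?_⟩
      simp only [eval_add, add_div]
      rw [hrx z hz, hsy z hz, darbouxMap_add hφ (continuousOn_eval_div hτ x)
        (continuousOn_eval_div hτ y) hz]
    | smul c x _ hx =>
      obtain ⟨r, hr, hrx⟩ := hx
      refine ⟨c • r, Submodule.smul_mem _ c hr, fun z hz => ?_⟩
      simp only [eval_smul, smul_eq_mul, mul_div_assoc]
      rw [hrx z hz, darbouxMap_const_mul]
  obtain ⟨r, hr, hrq⟩ := hspan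
  refine ⟨r, hr, ?_⟩
  set k := fun z => (f z * τ.eval z - q.eval z) / τ.eval z with hk
  have hkc : ContinuousOn k (Set.Icc (-1) 1) :=
    ((hf.mul τ.continuousOn).sub q.continuousOn).div τ.continuousOn hτ
  have hsub : ∀ z ∈ Set.Icc (-1 : ℝ) 1, (g z - r.eval z) / σ.eval z = darbouxMap φ t k z := by
    intro z hz
    have h2 : darbouxMap φ t f z
        = darbouxMap φ t k z + darbouxMap φ t (fun u => q.eval u / τ.eval u) z := by
      rw [← darbouxMap_add hφ hkc (continuousOn_eval_div hτ q) hz]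
      refine darbouxMap_congr (fun x hx => ?_) hz
      have := hτ x hx
      simp only [hk]
      field_simp
      ring
    have h3 : g z / σ.eval z = darbouxMap φ t f z := (hfg z hz).symm
    rw [sub_div, h3, h2, hrq z hz, add_sub_cancel_right]
  rw [prim_congr (fun x hx => by rw [hsub x hx]) h1]
  calc _ ≤ C * prim (fun u => k u * k u) 1 := hC k hkc
    _ < ε := by rwa [mul_comm, ← lt_div_iff₀ hC0]

end ExcLegendre

end

/-! ### Assembly of the theorem -/

open ExcLegendre in
theorem mainTheorem3
    (τ : Polynomial ℝ) (lam : ℕ → ℝ) (π : ℕ → Polynomial ℝ) (ν : ℕ → ℝ)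
    (hfam : ExcLegendre.IsExceptionalLegendreFamily τ lam π)
    (hν : ∀ i, 0 < ν i)
    (hnorm : ∀ i j,
      ∫ u in (-1 : ℝ)..1, (π i).eval u * (π j).eval u / (τ.eval u) ^ 2
        = if i = j then ν i else 0)
    (m : ℕ) (t : ℝ)
    -- `τm` and `πm i` are the polynomials given on `[-1,1]` by the transformation formulas
    (τm : Polynomial ℝ) (πm : ℕ → Polynomial ℝ)
    (hτm : ∀ z ∈ Set.Icc (-1 : ℝ) 1, τm.eval z = ExcLegendre.tauStep τ π m t z)
    (hπm : ∀ i, ∀ z ∈ Set.Icc (-1 : ℝ) 1, (πm i).eval z = ExcLegendre.piStep τ π m t i z) :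
    ((∀ z ∈ Set.Icc (-1 : ℝ) 1, 0 < τ.eval z) →
      ((∀ z ∈ Set.Icc (-1 : ℝ) 1, 0 < τm.eval z) ↔ 0 < ExcLegendre.nuStep ν m t m)) ∧
    ((∀ z ∈ Set.Icc (-1 : ℝ) 1, τm.eval z ≠ 0) ↔ 0 < ExcLegendre.nuStep ν m t m) ∧
    (0 < ExcLegendre.nuStep ν m t m →
      ExcLegendre.IsExceptionalLegendreFamily τm lam πm ∧
      ∀ i j,
        ∫ u in (-1 : ℝ)..1, (πm i).eval u * (πm j).eval u / (τm.eval u) ^ 2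
          = if i = j then ExcLegendre.nuStep ν m t i else 0) := by
  have hτ := hfam.nonvanishing
  have h1 : (1 : ℝ) ∈ Set.Icc (-1 : ℝ) 1 := by norm_num
  set φ : ℕ → ℝ → ℝ := fun i u => (π i).eval u / τ.eval u
  have hφ : ∀ i, ContinuousOn (φ i) (Set.Icc (-1) 1) := fun i => continuousOn_eval_div hτ (π i)
  have hnorm' : ∀ i j, prim (fun u => φ i u * φ j u) 1 = if i = j then ν i else 0 := by
    intro i j
    rw [← hnorm i j, ← congrFun (rho_eq_prim τ π i j) 1, rho]
  have hR1 : darbouxFactor (φ m) t 1 = 1 + t * ν m := by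
    rw [darbouxFactor, hnorm', if_pos rfl]
  have hτm' : ∀ z ∈ Set.Icc (-1 : ℝ) 1, τm.eval z = τ.eval z * darbouxFactor (φ m) t z :=
    fun z hz => by rw [hτm z hz, tauStep_eq]
  have hpos_iff : 0 < nuStep ν m t m ↔ 0 < darbouxFactor (φ m) t 1 := by
    have hm := hν m
    have e : 1 + t * ν m = (t + (ν m)⁻¹) * ν m := by field_simp; ring
    -- If `t = -1/ν_m`, the convention `0⁻¹ = 0` makes `nuStep` zero, so the equivalence includes
    -- this case.
    rw [nuStep, if_pos rfl, inv_pos, hR1, e, mul_pos_iff_of_pos_right hm]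
  have hne_iff : (∀ z ∈ Set.Icc (-1 : ℝ) 1, τm.eval z ≠ 0) ↔ 0 < nuStep ν m t m := by
    rw [hpos_iff, ← darbouxFactor_ne_zero_iff (hφ m)]
    refine forall₂_congr fun z hz => ?_
    rw [hτm' z hz, mul_ne_zero_iff, and_iff_right (hτ z hz)]
  refine ⟨fun hpos => ?_, hne_iff, fun hpos => ?_⟩
  · rw [hpos_iff, ← darbouxFactor_pos_iff (hφ m)]
    refine forall₂_congr fun z hz => ?_
    rw [hτm' z hz, mul_pos_iff_of_pos_left (hpos z hz)]
  have hσ := hne_iff.2 hpos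
  have hR := (darbouxFactor_ne_zero_iff (hφ m)).2 (hpos_iff.1 hpos)
  have hmap : ∀ i, ∀ z ∈ Set.Icc (-1 : ℝ) 1,
      (πm i).eval z / τm.eval z = darbouxMap (φ m) t (φ i) z := fun i z hz => by
    rw [hτm z hz, hπm i z hz]
    exact piStep_div_tauStep π i (hτ z hz) (hR z hz)
  have hint : ∀ i j, ∫ u in (-1 : ℝ)..1, (πm i).eval u * (πm j).eval u / (τm.eval u) ^ 2
      = if i = j then nuStep ν m t i else 0 := by
    intro i j
    have e : ∫ u in (-1 : ℝ)..1, (πm i).eval u * (πm j).eval u / (τm.eval u) ^ 2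
        = prim (fun u => darbouxMap (φ m) t (φ i) u * darbouxMap (φ m) t (φ j) u) 1 :=
      prim_congr (fun z hz => by rw [← hmap i z hz, ← hmap j z hz, div_mul_div_comm, sq]) h1
    rw [e, prim_darbouxMap_mul (hφ i) (hφ j) (hφ m) hR h1, hnorm', hnorm', hnorm', hR1, nuStep]
    have hm := (hν m).ne'
    have hR1' : 1 + t * ν m ≠ 0 := hR1 ▸ hR 1 h1
    by_cases hij : i = j
    · subst hij
      by_cases him : i = m
      · subst him
        have e2 : t + (ν i)⁻¹ = (1 + t * ν i) / ν i := by field_simp; ring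
        simp only [if_true]
        rw [e2, inv_div, eq_div_iff hR1', sub_mul, div_mul_cancel₀ _ hR1']
        ring
      · simp [him]
    · by_cases him : i = m
      · subst him
        simp [hij, Ne.symm hij]
      · simp [hij, him]
  have hνm : ∀ i, 0 < nuStep ν m t i := fun i => by
    by_cases him : i = m
    · rwa [him]
    · rw [nuStep, if_neg him]
      exact hν i
  -- A zero polynomial would have zero norm, against `hνm`.
  have hne : ∀ i, πm i ≠ 0 := fun i h0 => by
    have := hint i i
    simp only [h0, eval_zero, zero_mul, zero_div, intervalIntegral.integral_zero, if_true] at this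
    exact (hνm i).ne this
  have heig : ∀ i, eigenPoly τ (lam i) (π i) = 0 := fun i =>
    (hfam.sturmLiouville i).eigenPoly_eq_zero hτ
  have heig' : ∀ i, eigenPoly τm (lam i) (πm i) = 0 := fun i =>
    eigenPoly_step hτ (heig i) (heig m) hτm (hπm i)
  have hτ0 : τ ≠ 0 := fun h => hτ 1 h1 (by simp [h])
  have hτm0 : τm ≠ 0 := fun h => hσ 1 h1 (by simp [h])
  refine ⟨⟨hσ, hfam.distinct, fun i => isSLEigenfunction_of_eigenPoly hσ (hne i) (heig' i), ?_,
    fun i j hij => by rw [hint, if_neg hij], ?_⟩, hint⟩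
  · exact finite_missing_degrees hτ0 hτm0 (fun i => (hfam.sturmLiouville i).ne_zero) hne heig heig'
      hfam.degrees
  · refine hfam.complete.darboux hτ hσ (hφ m) hR ?_ hmap
    rw [hnorm', if_pos rfl]
    exact hν m
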